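/- Let $S$ be a unital semigroup with unit $e$ and an involution $\mathfrak I$ (that is, $\mathfrak I(\mathfrak I(a))=a$ and $\mathfrak I(ab)=\mathfrak I(b)\mathfrak I(a)$), and let $\phi:S\times X\to X$ be an action of $S$ on a set $X$: $\phi(a,\phi(b,x))=\phi(ab,x)$, $\phi(e,x)=x$. Let $\alpha:S\times X\to\mathbb C\setminus\{0\}$ satisfy, for all $a,b\in S$ and $x,y\in X$, $$\alpha(ab,x)\overline{\alpha(ab,y)}=\alpha(a,\phi(b,x))\overline{\alpha(a,\phi(b,y))}\,\alpha(b,x)\overline{\alpha(b,y)},\qquad \alpha(a\mathfrak I(a),x)=1 .$$ Then $\sigma(a,b)=\alpha(a,\phi(b,x))^{-1}\alpha(b,x)^{-1}\alpha(ab,x)$ does not depend on $x\in X$. Let $(\mathcal H,[\cdot,\cdot]_{\mathcal H})$ be a complex Krein space and let $\sharp$ denote adjoints with respect to indefinite inner products. A hermitian kernel is a map $K:X\times X\to\mathcal L(\mathcal H)$ with $K(x,y)=K(y,x)^\sharp$. For finitely supported $f,g:X\to\mathcal H$ put $[f,g]_K=\sum_{x,y}[K(x,y)f(y),g(x)]_{\mathcal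 H}$. For hermitian kernels, $A\le B$ means $[f,f]_A\le[f,f]_B$ for all $f$, and $A$ is positive definite if $0\le A$. Two positive definite kernels $A,B$ are disjoint if $P=0$ is the only positive definite kernel with $P\le A$ and $P\le B$. A positive definite kernel $L$ is $\phi$-bounded if for every $a\in S$ the linear map $\psi_a$ on finitely supported functions determined by $\psi_a(\xi_x)=\alpha(a,x)^{-1}\xi_{\phi(a,x)}$ is bounded for the seminorm $[\cdot,\cdot]_L^{1/2}$, where $\xi_x$ is the function with value $\xi$ at $x$ and $0$ elsewhere. A kernel $K$ is $\phi$-invariant if $$K(x,\phi(a,y))=\overline{\alpha(a,\phi(\mathfrak I(a),x))}\,\alpha(a,y)\,K(\phi(\mathfrak I(a),x),y)\qquad(x,y\in X,\ a\in S).$$ Let $K$ be an $\mathcal L(\mathcal H)$-valued $\phi$-invariant hermitian kernel on $X$. The following assertions are equivalent: (1) There is a positive definite, $\phi$-bounded, $\phi$-invariant kernel $L$ with $-L\le K\le L$. (2) There are a Krein space $\mathcal K$, bounded operators $V(x)\in\mathcal L(\mathcal H,\mathcal K)$ $(x\in X)$ with $K(x,y)=V(x)^\sharp V(y)$ for all $x,y\in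 X$ and with $\bigcup_{x}V(x)\mathcal H$ spanning a dense subspace of $\mathcal K$, and operators $U(a)\in\mathcal L(\mathcal K)$ $(a\in S)$ with $U(a)U(b)=\sigma(a,b)U(ab)$ and $V(\phi(a,x))=\alpha(a,x)U(a)V(x)$ for all $a,b\in S$, $x\in X$, such that some fundamental symmetry $J$ of $\mathcal K$ satisfies $U(a)J=JU(a)$ for all $a\in S$. (3) $K=K_+-K_-$ for two disjoint positive definite $\phi$-invariant kernels $K_\pm$ such that $K_++K_-$ is $\phi$-bounded. -/

import Mathlib

open Filter Topology

universe u v w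

noncomputable section

namespace KreinKernel

/-- A Krein space structure on a complex Hilbert space with positive inner product `⟨·,·⟩`:
a symmetry `J` (`J = J* = J⁻¹`). The indefinite inner product is `[ξ, η] = ⟨J ξ, η⟩`.
Every Krein space is of this form, and the indefinite inner product, the (strong) topology, the
bounded operators and their adjoints do not depend on the Hilbert space structure chosen. -/
class KreinSpace (H : Type*) [NormedAddCommGroup H] [InnerProductSpace ℂ H]
    [CompleteSpace H] where
  symmetry : H →L[ℂ] H
  symmetry_selfAdjoint : ContinuousLinearMap.adjoint symmetry = symmetry
  symmetry_involutive : ∀ ξ : H, symmetry (symmetry ξ) = ξ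

section Krein

variable {H : Type*} [NormedAddCommGroup H] [InnerProductSpace ℂ H] [CompleteSpace H]
  [KreinSpace H]
variable {G : Type*} [NormedAddCommGroup G] [InnerProductSpace ℂ G] [CompleteSpace G]
  [KreinSpace G]

/-- The indefinite inner product `[ξ, η] = ⟨J ξ, η⟩`, linear in `ξ` and conjugate linear in `η`
(Mathlib's `inner` is linear in its second argument). -/
def form (ξ η : H) : ℂ := inner ℂ η (KreinSpace.symmetry ξ)

/-- The adjoint `T♯` of `T` with respect to the indefinite inner products. -/
def sharp (T : H →L[ℂ] G) : G →L[ℂ] H :=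
  (KreinSpace.symmetry : H →L[ℂ] H) ∘L ContinuousLinearMap.adjoint T ∘L
    (KreinSpace.symmetry : G →L[ℂ] G)

theorem symmetry_inner (ξ η : H) :
    inner ℂ (KreinSpace.symmetry ξ) η = inner ℂ ξ (KreinSpace.symmetry η) := by
  rw [← ContinuousLinearMap.adjoint_inner_right, KreinSpace.symmetry_selfAdjoint]

/-- `T♯` is the adjoint of `T` with respect to the indefinite inner products. -/
theorem form_sharp (T : H →L[ℂ] G) (ξ : H) (η : G) :
    form (T ξ) η = form ξ (sharp T η) := by
  simp only [form, sharp, ContinuousLinearMap.comp_apply]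
  rw [symmetry_inner, KreinSpace.symmetry_involutive, ContinuousLinearMap.adjoint_inner_left,
    symmetry_inner]

/-- `F` is a fundamental symmetry of the Krein space: there is a positive inner product,
necessarily `⟨ξ, η⟩_F = [F ξ, η]`, which turns the space into a Hilbert space, for which `F` is
a symmetry and `[ξ, η] = ⟨F ξ, η⟩_F`. -/
structure IsFundamentalSymmetry (F : H →L[ℂ] H) : Prop where
  involutive : ∀ ξ : H, F (F ξ) = ξ
  selfAdjoint : sharp F = F
  pos : ∀ ξ : H, ξ ≠ 0 → 0 < (form (F ξ) ξ).re
  complete : ∀ u : ℕ → H,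
    (∀ ε : ℝ, 0 < ε → ∃ N : ℕ, ∀ m n : ℕ, N ≤ m → N ≤ n →
      √(form (F (u m - u n)) (u m - u n)).re < ε) →
    ∃ l : H, Tendsto (fun n => √(form (F (u n - l)) (u n - l)).re) atTop (𝓝 0)

end Krein

section Kernels

variable {X : Type*} {H : Type*} [NormedAddCommGroup H] [InnerProductSpace ℂ H]
  [CompleteSpace H] [KreinSpace H]

/-- Hermitian kernel: `K(x, y) = K(y, x)♯`. -/
def IsHermitian (K : X → X → H →L[ℂ] H) : Prop :=
  ∀ x y : X, K x y = sharp (K y x)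

/-- The inner product `[f, g]_K = ∑_{x,y} [K(x, y) f(y), g(x)]` on the finitely supported
`H`-valued functions on `X`. -/
def kernelForm (K : X → X → H →L[ℂ] H) (f g : X →₀ H) : ℂ :=
  ∑ x ∈ g.support, ∑ y ∈ f.support, form (K x y (f y)) (g x)

/-- Positive definite kernel: a hermitian kernel with `[f, f]_L ≥ 0` for all `f`
(`[f, f]_L` is real for a hermitian kernel). -/
def IsPosDef (L : X → X → H →L[ℂ] H) : Prop :=
  IsHermitian L ∧ ∀ f : X →₀ H, 0 ≤ (kernelForm L f f).re

/-- The order on hermitian kernels: `[f, f]_A ≤ [f, f]_B` for all `f`. -/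
def KernelLE (A B : X → X → H →L[ℂ] H) : Prop :=
  ∀ f : X →₀ H, (kernelForm A f f).re ≤ (kernelForm B f f).re

/-- Disjointness of two positive definite kernels. -/
def AreDisjoint (A B : X → X → H →L[ℂ] H) : Prop :=
  ∀ P : X → X → H →L[ℂ] H, IsPosDef P → KernelLE P A → KernelLE P B → P = 0

/-- `(V; 𝒦)` is a Kolmogorov decomposition of `K`. -/
def IsKolmogorovDecomposition {𝒦 : Type*} [NormedAddCommGroup 𝒦] [InnerProductSpace ℂ 𝒦]
    [CompleteSpace 𝒦] [KreinSpace 𝒦]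
    (K : X → X → H →L[ℂ] H) (V : X → H →L[ℂ] 𝒦) : Prop :=
  (∀ x y : X, K x y = sharp (V x) ∘L V y) ∧
    Dense (Submodule.span ℂ {k : 𝒦 | ∃ (x : X) (ξ : H), V x ξ = k} : Set 𝒦)

end Kernels

section Action

variable {S : Type*} [Monoid S] {X : Type*} [MulAction S X]

/-- The relation `α(ab,x) conj α(ab,y) =
α(a,φ(b,x)) conj α(a,φ(b,y)) α(b,x) conj α(b,y)`, where `φ(a,x) = a • x`. -/
def IsMultiplier (α : S → X → ℂ) : Prop :=
  ∀ (a b : S) (x y : X), α (a * b) x * star (α (a * b) y) =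
    α a (b • x) * star (α a (b • y)) * α b x * star (α b y)

/-- `σ(a, b)`, computed at the point `x`. -/
def cocycle (α : S → X → ℂ) (a b : S) (x : X) : ℂ :=
  (α a (b • x))⁻¹ * (α b x)⁻¹ * α (a * b) x

/-- `σ(a, b)` does not depend on the point `x`. -/
theorem cocycle_eq {α : S → X → ℂ} (h0 : ∀ a x, α a x ≠ 0) (hα : IsMultiplier α)
    (a b : S) (x y : X) : cocycle α a b x = cocycle α a b y := by
  have hs : ∀ c z, star (α c z) ≠ 0 := fun c z => star_ne_zero.mpr (h0 c z)
  have e1 := hα a b x y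
  have e2 := hα a b y y
  have k1 : cocycle α a b x * star (α (a * b) y) =
      star (α a (b • y)) * star (α b y) := by
    unfold cocycle
    have := h0 a (b • x)
    have := h0 b x
    field_simp
    rw [e1]; ring
  have k2 : cocycle α a b y * star (α (a * b) y) =
      star (α a (b • y)) * star (α b y) := by
    unfold cocycle
    have := h0 a (b • y)
    have := h0 b y
    field_simp
    rw [e2]; ring
  exact mul_right_cancel₀ (hs (a * b) y) (k1.trans k2.symm)

variable {H : Type*} [NormedAddCommGroup H] [InnerProductSpace ℂ H]

/-- The linear map `ψ_a` on the finitely supported functions with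
`ψ_a(ξ_x) = α(a,x)⁻¹ ξ_{φ(a,x)}`. -/
def psi (α : S → X → ℂ) (a : S) : (X →₀ H) →ₗ[ℂ] (X →₀ H) :=
  Finsupp.lsum ℂ fun x : X => (α a x)⁻¹ • Finsupp.lsingle (a • x)

variable [CompleteSpace H] [KreinSpace H]

/-- The positive definite kernel `L` is `φ`-bounded: each `ψ_a` is bounded with respect to the
seminorm `[·,·]_L^{1/2}`. -/
def IsPhiBounded (α : S → X → ℂ) (L : X → X → H →L[ℂ] H) : Prop :=
  ∀ a : S, ∃ C : ℝ, ∀ h : X →₀ H,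
    √(kernelForm L (psi α a h) (psi α a h)).re ≤ C * √(kernelForm L h h).re

/-- The kernel `K` is `φ`-invariant (the involution of `S` is `star`). -/
def IsPhiInvariant [StarMul S] (α : S → X → ℂ) (K : X → X → H →L[ℂ] H) : Prop :=
  ∀ (a : S) (x y : X), K x (a • y) =
    (star (α a (star a • x)) * α a y) • K (star a • x) y

/-- `U` is a projective representation of `S` with the cocycle `σ` of `α`:
`U(a) U(b) = σ(a, b) U(ab)`. -/
def IsProjectiveRepresentation (α : S → X → ℂ) (U : S → H →L[ℂ] H) : Prop :=
  ∀ (a b : S) (x : X), U a ∘L U b = cocycle α a b x • U (a * b)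

/-- `U` is fundamentally reducible. -/
def IsFundamentallyReducible (U : S → H →L[ℂ] H) : Prop :=
  ∃ F : H →L[ℂ] H, IsFundamentalSymmetry F ∧ ∀ a : S, U a ∘L F = F ∘L U a

end Action

end KreinKernel

end

noncomputable section

namespace KreinKernel

open ContinuousLinearMap

/-! ### The indefinite inner product -/

section Form

variable {H : Type*} [NormedAddCommGroup H] [InnerProductSpace ℂ H] [CompleteSpace H]
  [KreinSpace H]

/-! The kernels are translated into operators on one Hilbert space. A positive definite kernel `L`
factors as `V(x)♯ V(y)` through a Hilbert space in which the vectors `V(x) ξ` span a dense subspace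
(`IsPosDef.exists_dilation`). Positive definite kernels below a multiple of `L` are then exactly the
kernels `V(x)♯ A V(y)` with `A ≥ 0` (`IsPosDef.exists_compression`), and the order of kernels is the
order of operators. If `L` is `φ`-bounded, the maps `ψ_a` become bounded operators `U(a)`, and
invariance of the kernel of `A` means `A U(a) = c(a) U(𝔍(a))* A` (`isPhiInvariant_compression_iff`).
When `L` itself is invariant, the case `A = 1` turns this into `A U(a) = U(a) A`.

(1) → (3): `K` comes from a selfadjoint `A` commuting with every `U(a)`; its positive and negative
parts give `K₊` and `K₋`. (3) → (2): with `L = K₊ + K₋` the two kernels come from `P, Q ≥ 0` with `P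
+ Q = 1`. Disjointness forces `PQ = 0`, so `P - Q` is a symmetry; it commutes with `U` and defines
the Krein space. (2) → (1): if `F` is a fundamental symmetry commuting with `U`, take `L(x,y) =
V(x)♯ F V(y)`. It dominates `±K` because the `F`-inner product dominates `±[·,·]`. -/

theorem form_add_left (ξ ξ' η : H) : form (ξ + ξ') η = form ξ η + form ξ' η := by
  simp [form]

theorem form_smul_left (c : ℂ) (ξ η : H) : form (c • ξ) η = c * form ξ η := by
  simp [form]

theorem form_zero_left (η : H) : form 0 η = 0 := by simp [form]

theorem form_zero_right (ξ : H) : form ξ 0 = 0 := by simp [form]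

theorem star_form (ξ η : H) : star (form ξ η) = form η ξ := by
  simp only [form]
  rw [← symmetry_inner]
  exact inner_conj_symm _ _

theorem eq_of_form_eq {ξ ξ' : H} (h : ∀ η, form ξ η = form ξ' η) : ξ = ξ' := by
  have : (KreinSpace.symmetry ξ : H) = KreinSpace.symmetry ξ' :=
    ext_inner_left ℂ fun η => h η
  rw [← KreinSpace.symmetry_involutive ξ, this, KreinSpace.symmetry_involutive]

end Form

/-! ### The sesquilinear form of a kernel -/

section KernelForm

variable {X : Type*} {H : Type*} [NormedAddCommGroup H] [InnerProductSpace ℂ H]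
  [CompleteSpace H] [KreinSpace H]

theorem kernelForm_eq_sum (K : X → X → H →L[ℂ] H) (f g : X →₀ H) :
    kernelForm K f g = g.sum fun x η => f.sum fun y ξ => form (K x y ξ) η := rfl

theorem kernelForm_add_left (K : X → X → H →L[ℂ] H) (f f' g : X →₀ H) :
    kernelForm K (f + f') g = kernelForm K f g + kernelForm K f' g := by
  classical
  simp only [kernelForm_eq_sum]
  rw [← Finsupp.sum_add]
  refine Finsupp.sum_congr fun x _ => ?_
  refine Finsupp.sum_add_index' (fun y => ?_) (fun y ξ ξ' => ?_)
  · simp [form_zero_left]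
  · simp [form_add_left]

theorem kernelForm_smul_left (K : X → X → H →L[ℂ] H) (c : ℂ) (f g : X →₀ H) :
    kernelForm K (c • f) g = c * kernelForm K f g := by
  simp only [kernelForm_eq_sum]
  rw [Finsupp.sum, Finsupp.sum, Finset.mul_sum]
  refine Finset.sum_congr rfl fun x _ => ?_
  rw [Finsupp.sum_smul_index' (fun y => by simp [form_zero_left]), Finsupp.sum, Finsupp.sum,
    Finset.mul_sum]
  simp [form_smul_left]

theorem star_kernelForm {K : X → X → H →L[ℂ] H} (hK : IsHermitian K) (f g : X →₀ H) :
    star (kernelForm K f g) = kernelForm K g f := by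
  simp only [kernelForm, star_sum]
  rw [Finset.sum_comm]
  refine Finset.sum_congr rfl fun y _ => Finset.sum_congr rfl fun x _ => ?_
  rw [star_form, form_sharp, ← hK]

theorem kernelForm_single (K : X → X → H →L[ℂ] H) (x y : X) (ξ η : H) :
    kernelForm K (Finsupp.single y ξ) (Finsupp.single x η) = form (K x y ξ) η := by
  classical
  rw [kernelForm_eq_sum, Finsupp.sum_single_index, Finsupp.sum_single_index]
  · simp [form_zero_left]
  · simp [form_zero_right, Finsupp.sum]

theorem kernel_ext {K K' : X → X → H →L[ℂ] H}
    (h : ∀ f g, kernelForm K f g = kernelForm K' f g) : K = K' := by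
  ext x y ξ
  refine eq_of_form_eq fun η => ?_
  rw [← kernelForm_single, ← kernelForm_single, h]

theorem kernelForm_add (K K' : X → X → H →L[ℂ] H) (f g : X →₀ H) :
    kernelForm (K + K') f g = kernelForm K f g + kernelForm K' f g := by
  simp [kernelForm, form_add_left, Finset.sum_add_distrib]

theorem kernelForm_neg (K : X → X → H →L[ℂ] H) (f g : X →₀ H) :
    kernelForm (-K) f g = -kernelForm K f g := by
  simp [kernelForm, form]

theorem kernelForm_sub (K K' : X → X → H →L[ℂ] H) (f g : X →₀ H) :
    kernelForm (K - K') f g = kernelForm K f g - kernelForm K' f g := by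
  rw [sub_eq_add_neg, kernelForm_add, kernelForm_neg, sub_eq_add_neg]

theorem IsHermitian.add {K K' : X → X → H →L[ℂ] H} (hK : IsHermitian K)
    (hK' : IsHermitian K') : IsHermitian (K + K') := by
  intro x y
  change K x y + K' x y = sharp (K y x + K' y x)
  rw [hK x y, hK' x y]
  simp [sharp, comp_add, add_comp]

end KernelForm

/-! ### Kernels obtained from operators -/

section Compression

variable {X : Type*} {H : Type*} [NormedAddCommGroup H] [InnerProductSpace ℂ H]
  {G : Type*} [NormedAddCommGroup G] [InnerProductSpace ℂ G]

/-- The map `f ↦ ∑ x, V(x) f(x)` on the finitely supported functions. -/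
def synthesis (V : X → H →L[ℂ] G) : (X →₀ H) →ₗ[ℂ] G :=
  Finsupp.lsum ℂ fun x => (V x : H →ₗ[ℂ] G)

theorem synthesis_apply (V : X → H →L[ℂ] G) (f : X →₀ H) :
    synthesis V f = f.sum fun x ξ => V x ξ := rfl

theorem synthesis_single (V : X → H →L[ℂ] G) (x : X) (ξ : H) :
    synthesis V (Finsupp.single x ξ) = V x ξ := by
  simp [synthesis]

theorem range_synthesis (V : X → H →L[ℂ] G) :
    Set.range (synthesis V) = (Submodule.span ℂ {k : G | ∃ (x : X) (ξ : H), V x ξ = k} : Set G) := by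
  rw [← LinearMap.coe_range]
  congr 1
  apply le_antisymm
  · rintro _ ⟨f, rfl⟩
    rw [synthesis_apply]
    exact Submodule.sum_mem _ fun x _ => Submodule.subset_span ⟨x, _, rfl⟩
  · rw [Submodule.span_le]
    rintro _ ⟨x, ξ, rfl⟩
    exact ⟨Finsupp.single x ξ, synthesis_single V x ξ⟩

theorem clm_ext_of_denseRange {E : Type*} [NormedAddCommGroup E] [NormedSpace ℂ E]
    {V : X → H →L[ℂ] G} (hV : DenseRange (synthesis V)) {A B : G →L[ℂ] E}
    (h : ∀ x, A ∘L V x = B ∘L V x) : A = B := by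
  apply coeFn_injective
  refine hV.equalizer A.continuous B.continuous ?_
  funext f
  simp only [Function.comp, synthesis_apply, Finsupp.sum, map_sum]
  exact Finset.sum_congr rfl fun x _ => congr($(h x) (f x))

variable [CompleteSpace H] [KreinSpace H] [CompleteSpace G]

/-- The kernel `V(x)♯ A V(y)`, the adjoint being taken between the indefinite inner product of
`H` and the positive one of `G`. -/
def compression (V : X → H →L[ℂ] G) (A : G →L[ℂ] G) : X → X → H →L[ℂ] H := fun x y =>
  (KreinSpace.symmetry : H →L[ℂ] H) ∘L adjoint (V x) ∘L A ∘L V y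

theorem form_compression (V : X → H →L[ℂ] G) (A : G →L[ℂ] G) (x y : X) (ξ η : H) :
    form (compression V A x y ξ) η = inner ℂ (V x η) (A (V y ξ)) := by
  simp only [form, compression, comp_apply, KreinSpace.symmetry_involutive, adjoint_inner_right]

theorem kernelForm_compression (V : X → H →L[ℂ] G) (A : G →L[ℂ] G) (f g : X →₀ H) :
    kernelForm (compression V A) f g = inner ℂ (synthesis V g) (A (synthesis V f)) := by
  simp only [kernelForm, form_compression, synthesis_apply, Finsupp.sum, map_sum, sum_inner,
    inner_sum]
  exact Finset.sum_comm

theorem compression_add (V : X → H →L[ℂ] G) (A B : G →L[ℂ] G) :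
    compression V (A + B) = compression V A + compression V B := by
  refine kernel_ext fun f g => ?_
  simp [kernelForm_add, kernelForm_compression]

theorem compression_sub (V : X → H →L[ℂ] G) (A B : G →L[ℂ] G) :
    compression V (A - B) = compression V A - compression V B := by
  refine kernel_ext fun f g => ?_
  simp [kernelForm_sub, kernelForm_compression]

theorem compression_zero (V : X → H →L[ℂ] G) : compression V 0 = 0 := by
  ext x y ξ
  simp [compression]

theorem compression_injective {V : X → H →L[ℂ] G} (hV : DenseRange (synthesis V))
    {A B : G →L[ℂ] G} (h : compression V A = compression V B) : A = B := by
  refine clm_ext_of_denseRange hV fun y => ?_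
  ext ξ
  refine ext_inner_left ℂ fun w => congrFun (hV.equalizer (g := fun w => inner ℂ w (A (V y ξ)))
    (h := fun w => inner ℂ w (B (V y ξ))) (by fun_prop) (by fun_prop) ?_) w
  funext g
  rw [← synthesis_single V y ξ]
  simp only [Function.comp, ← kernelForm_compression, h]

theorem isHermitian_compression (V : X → H →L[ℂ] G) {A : G →L[ℂ] G} (hA : IsSelfAdjoint A) :
    IsHermitian (compression V A) := by
  intro x y
  have hs : adjoint (KreinSpace.symmetry : H →L[ℂ] H) = KreinSpace.symmetry :=
    KreinSpace.symmetry_selfAdjoint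
  ext ξ
  simp only [compression, sharp, adjoint_comp, adjoint_adjoint, hs, hA.adjoint_eq, comp_apply,
    KreinSpace.symmetry_involutive]

theorem isPosDef_compression (V : X → H →L[ℂ] G) {A : G →L[ℂ] G} (hA : 0 ≤ A) :
    IsPosDef (compression V A) := by
  rw [nonneg_iff_isPositive] at hA
  refine ⟨isHermitian_compression V hA.isSelfAdjoint, fun f => ?_⟩
  rw [kernelForm_compression]
  exact hA.re_inner_nonneg_right _

end Compression

/-! ### Hilbert space factorization of positive definite kernels -/

section Dilation

variable {X : Type u} {H : Type v} [NormedAddCommGroup H] [InnerProductSpace ℂ H]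
  [CompleteSpace H] [KreinSpace H]

/-- The finitely supported functions, to be equipped with the inner product `[·,·]_L`. -/
@[nolint unusedArguments]
def PreDilation {L : X → X → H →L[ℂ] H} (_ : IsPosDef L) : Type (max u v) := X →₀ H

namespace PreDilation

variable {L : X → X → H →L[ℂ] H} (hL : IsPosDef L)

instance : AddCommGroup (PreDilation hL) := inferInstanceAs (AddCommGroup (X →₀ H))
instance : Module ℂ (PreDilation hL) := inferInstanceAs (Module ℂ (X →₀ H))

/-- The identity as a linear equivalence. -/
def equiv : (X →₀ H) ≃ₗ[ℂ] PreDilation hL := LinearEquiv.refl ℂ _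

/-- The inner product `⟨g, f⟩ = [f, g]_L`. -/
abbrev core : PreInnerProductSpace.Core ℂ (PreDilation hL) where
  inner g f := kernelForm L ((equiv hL).symm f) ((equiv hL).symm g)
  conj_inner_symm _ _ := star_kernelForm hL.1 _ _
  re_inner_nonneg _ := hL.2 _
  add_left g g' f := by
    rw [← star_kernelForm hL.1, map_add, kernelForm_add_left, star_add, star_kernelForm hL.1,
      star_kernelForm hL.1]
  smul_left g f c := by
    rw [← star_kernelForm hL.1, map_smul, kernelForm_smul_left, star_mul', star_kernelForm hL.1]
    rfl

instance : SeminormedAddCommGroup (PreDilation hL) :=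
  InnerProductSpace.Core.toSeminormedAddCommGroup (c := core hL)

instance : InnerProductSpace ℂ (PreDilation hL) := InnerProductSpace.ofCore (core hL)

theorem inner_equiv (f g : X →₀ H) :
    inner ℂ (equiv hL g) (equiv hL f) = kernelForm L f g := rfl

end PreDilation

/-- A positive definite kernel is of the form `V(x)♯ V(y)`, with `V(x)` acting into a Hilbert
space. -/
theorem IsPosDef.exists_dilation {L : X → X → H →L[ℂ] H} (hL : IsPosDef L) :
    ∃ (G : Type (max u v)) (_ : NormedAddCommGroup G) (_ : InnerProductSpace ℂ G)
      (_ : CompleteSpace G) (V : X → H →L[ℂ] G),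
      L = compression V 1 ∧ DenseRange (synthesis V) := by
  -- `[·,·]_L` may be degenerate; the completion also divides out its null vectors.
  let ι : (X →₀ H) →ₗ[ℂ] UniformSpace.Completion (PreDilation hL) :=
    (UniformSpace.Completion.toComplL (𝕜 := ℂ) (E := PreDilation hL)).toLinearMap ∘ₗ
      (PreDilation.equiv hL).toLinearMap
  have hι : ∀ f g, inner ℂ (ι g) (ι f) = kernelForm L f g := fun f g => by
    rw [← PreDilation.inner_equiv hL]
    exact UniformSpace.Completion.inner_coe _ _
  -- Boundedness of `V(x)` comes from `‖ξ_x‖² = [L(x,x) ξ, ξ]`.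
  have hb : ∀ (x : X) (ξ : H), ‖(ι ∘ₗ Finsupp.lsingle x) ξ‖ ≤
      √(‖(KreinSpace.symmetry : H →L[ℂ] H)‖ * ‖L x x‖) * ‖ξ‖ := fun x ξ => by
    rw [← Real.sqrt_sq (norm_nonneg ξ), ← Real.sqrt_mul (by positivity)]
    refine Real.le_sqrt_of_sq_le ?_
    rw [← inner_self_eq_norm_sq (𝕜 := ℂ)]
    change RCLike.re (inner ℂ (ι (Finsupp.single x ξ)) (ι (Finsupp.single x ξ))) ≤ _
    rw [hι, kernelForm_single]
    refine (RCLike.re_le_norm _).trans ((norm_inner_le_norm _ _).trans ?_)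
    calc ‖ξ‖ * ‖(KreinSpace.symmetry : H →L[ℂ] H) (L x x ξ)‖
        ≤ ‖ξ‖ * (‖(KreinSpace.symmetry : H →L[ℂ] H)‖ * (‖L x x‖ * ‖ξ‖)) := by
          gcongr
          exact (le_opNorm _ _).trans (by gcongr; exact le_opNorm _ _)
      _ = _ := by ring
  let V : X → H →L[ℂ] UniformSpace.Completion (PreDilation hL) := fun x =>
    (ι ∘ₗ Finsupp.lsingle x).mkContinuous _ (hb x)
  have hV : synthesis V = ι := by
    refine Finsupp.lhom_ext fun x ξ => ?_
    rw [synthesis_single]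
    rfl
  refine ⟨_, inferInstance, inferInstance, inferInstance, V, ?_, ?_⟩
  · refine kernel_ext fun f g => ?_
    rw [kernelForm_compression, hV, one_apply_eq_self, hι]
  · rw [hV]
    exact UniformSpace.Completion.denseRange_coe.comp (PreDilation.equiv hL).surjective.denseRange
      (UniformSpace.Completion.continuous_coe _)

end Dilation

/-! ### Radon–Nikodym theorem for dominated kernels -/

section Domination

variable {X : Type*} {H : Type*} [NormedAddCommGroup H] [InnerProductSpace ℂ H]
  [CompleteSpace H] [KreinSpace H]
  {G : Type*} [NormedAddCommGroup G] [InnerProductSpace ℂ G] [CompleteSpace G]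

/-- A kernel dominated by `C V(x)♯ V(y)` is of the form `V(x)♯ A V(y)` with `A ≥ 0`. -/
theorem IsPosDef.exists_compression {P : X → X → H →L[ℂ] H} (hP : IsPosDef P)
    {V : X → H →L[ℂ] G} (hV : DenseRange (synthesis V)) {C : ℝ}
    (h : ∀ f, (kernelForm P f f).re ≤ C * ‖synthesis V f‖ ^ 2) :
    ∃ A : G →L[ℂ] G, 0 ≤ A ∧ P = compression V A := by
  obtain ⟨G', _, _, _, V', rfl, -⟩ := hP.exists_dilation
  -- Domination makes `V f ↦ V' f`, with `V'` a dilation of `P`, well defined and bounded by `√C`.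
  -- Its extension `W` gives `A = W* W`.
  have hb : ∃ C', ∀ f, ‖synthesis V' f‖ ≤ C' * ‖synthesis V f‖ := by
    refine ⟨√C, fun f => ?_⟩
    rw [← Real.sqrt_sq (norm_nonneg (synthesis V f)), ← Real.sqrt_mul' _ (sq_nonneg _)]
    refine Real.le_sqrt_of_sq_le ?_
    rw [← inner_self_eq_norm_sq (𝕜 := ℂ)]
    have := h f
    rwa [kernelForm_compression, one_apply_eq_self] at this
  let W : G →L[ℂ] G' := (synthesis V').extendOfNorm (synthesis V)
  have hW : ∀ f, W (synthesis V f) = synthesis V' f := LinearMap.extendOfNorm_eq hV hb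
  refine ⟨adjoint W ∘L W, ?_, ?_⟩
  · rw [nonneg_iff_isPositive]
    exact isPositive_adjoint_comp_self W
  · refine kernel_ext fun f g => ?_
    rw [kernelForm_compression, kernelForm_compression, comp_apply, adjoint_inner_right, hW, hW,
      one_apply_eq_self]

end Domination

/-! ### Order and products in a C⋆-algebra -/

section CStarAlgebra

variable {A : Type*} [CStarAlgebra A] [PartialOrder A] [StarOrderedRing A]

/-- `a* b a = (√b a)* (√b a)`, so its vanishing gives `√b a = 0`. -/
theorem mul_eq_zero_of_conjugate_nonpos {a b : A} (hb : 0 ≤ b) (h : star a * b * a ≤ 0) :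
    b * a = 0 := by
  have h0 : star a * b * a = 0 := le_antisymm h (star_left_conjugate_nonneg hb a)
  have hs : star (CFC.sqrt b) = CFC.sqrt b := (CFC.sqrt_nonneg b).isSelfAdjoint
  have hss : CFC.sqrt b * CFC.sqrt b = b := CFC.sqrt_mul_sqrt_self b hb
  have : CFC.sqrt b * a = 0 := by
    rw [← CStarRing.star_mul_self_eq_zero_iff, star_mul, hs, mul_assoc, ← mul_assoc _ _ a, hss,
      ← mul_assoc, h0]
  rw [← hss, mul_assoc, this, mul_zero]

/-- Compress twice: `p b p ≤ p q p = 0` gives `b p = 0`, then `b b b ≤ b p b = 0` gives `b² = 0`.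
This yields disjointness of the kernels of `A⁺` and `A⁻`. -/
theorem eq_zero_of_le_of_le_of_mul_eq_zero {b p q : A} (hb : 0 ≤ b) (hbp : b ≤ p)
    (hbq : b ≤ q) (hqp : q * p = 0) : b = 0 := by
  have h1 : b * p = 0 := mul_eq_zero_of_conjugate_nonpos hb <| by
    refine (star_left_conjugate_le_conjugate hbq p).trans ?_
    rw [mul_assoc, hqp, mul_zero]
  have h2 : b * b = 0 := mul_eq_zero_of_conjugate_nonpos hb <| by
    refine (star_left_conjugate_le_conjugate hbp b).trans ?_
    rw [hb.isSelfAdjoint.star_eq, h1, zero_mul]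
  rwa [← CStarRing.star_mul_self_eq_zero_iff, hb.isSelfAdjoint.star_eq]

/-- Since `p` and `q = 1 - p` commute, `pq = pq(p + q) = pqp + qpq`. With the two bounds below, `pq`
becomes a test element for disjointness. -/
theorem mul_nonneg_of_add_eq_one {p q : A} (hp : 0 ≤ p) (hq : 0 ≤ q) (h : p + q = 1) :
    0 ≤ p * q := by
  obtain rfl : q = 1 - p := by rw [← h, add_sub_cancel_left]
  have e : p * (1 - p) = star p * (1 - p) * p + star (1 - p) * p * (1 - p) := by
    rw [hp.isSelfAdjoint.star_eq, hq.isSelfAdjoint.star_eq]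
    noncomm_ring
  rw [e]
  exact add_nonneg (star_left_conjugate_nonneg hq p) (star_left_conjugate_nonneg hp (1 - p))

theorem mul_le_of_add_eq_one {p q : A} (hp : 0 ≤ p) (h : p + q = 1) : p * q ≤ p := by
  obtain rfl : q = 1 - p := by rw [← h, add_sub_cancel_left]
  rw [← sub_nonneg, show p - p * (1 - p) = star p * p by
    rw [hp.isSelfAdjoint.star_eq]; noncomm_ring]
  exact star_mul_self_nonneg p

theorem mul_le_of_add_eq_one' {p q : A} (hq : 0 ≤ q) (h : p + q = 1) : p * q ≤ q := by
  obtain rfl : p = 1 - q := by rw [← h, add_sub_cancel_right]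
  rw [← sub_nonneg, show q - (1 - q) * q = star q * q by
    rw [hq.isSelfAdjoint.star_eq]; noncomm_ring]
  exact star_mul_self_nonneg q

end CStarAlgebra

/-! ### Order of kernels and order of operators -/

section Order

variable {X : Type*} {H : Type*} [NormedAddCommGroup H] [InnerProductSpace ℂ H]
  [CompleteSpace H] [KreinSpace H]
  {G : Type*} [NormedAddCommGroup G] [InnerProductSpace ℂ G] [CompleteSpace G]

theorem re_inner_eq_norm_sqrt_sq {A : G →L[ℂ] G} (hA : 0 ≤ A) (k : G) :
    (inner ℂ k (A k)).re = ‖CFC.sqrt A k‖ ^ 2 := by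
  have hs : IsSelfAdjoint (CFC.sqrt A) := (CFC.sqrt_nonneg A).isSelfAdjoint
  nth_rewrite 1 [← CFC.sqrt_mul_sqrt_self A hA]
  rw [← inner_self_eq_norm_sq (𝕜 := ℂ)]
  nth_rewrite 3 [← hs.adjoint_eq]
  rw [adjoint_inner_left]
  rfl

theorem kernelLE_compression (V : X → H →L[ℂ] G) {A B : G →L[ℂ] G} (h : A ≤ B) :
    KernelLE (compression V A) (compression V B) := by
  intro f
  rw [← sub_nonneg, nonneg_iff_isPositive] at h
  have := h.re_inner_nonneg_right (synthesis V f)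
  rw [kernelForm_compression, kernelForm_compression, ← sub_nonneg, ← Complex.sub_re,
    ← inner_sub_right]
  exact this

theorem le_of_kernelLE_compression {V : X → H →L[ℂ] G} (hV : DenseRange (synthesis V))
    {A B : G →L[ℂ] G} (hA : IsSelfAdjoint A) (hB : IsSelfAdjoint B)
    (h : KernelLE (compression V A) (compression V B)) : A ≤ B := by
  rw [← sub_nonneg, nonneg_iff_isPositive, isPositive_def']
  refine ⟨hB.sub hA, fun k => ?_⟩
  refine hV.induction_on (p := fun k => 0 ≤ (B - A).reApplyInnerSelf k) k ?_ fun f => ?_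
  · exact isClosed_le continuous_const (reApplyInnerSelf_continuous _)
  · have := h f
    rw [kernelForm_compression, kernelForm_compression] at this
    rw [← sub_nonneg, ← Complex.sub_re, ← inner_sub_right] at this
    rw [reApplyInnerSelf_apply, inner_re_symm]
    exact this

end Order

/-! ### Invariance and boundedness under the action -/

section Action

variable {S : Type*} [Monoid S] {X : Type*} [MulAction S X]

/-- The function `x ↦ conj (α(a, 𝔍(a) x) α(𝔍(a), x))` is constant. -/
theorem exists_star_cocycle [StarMul S] {α : S → X → ℂ} (hα_mul : IsMultiplier α)
    (hα_star : ∀ (a : S) (x : X), α (a * star a) x = 1) :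
    ∃ c : S → ℂ, ∀ a x, star (α a (star a • x)) * star (α (star a) x) = c a := by
  rcases isEmpty_or_nonempty X with _ | ⟨⟨x₀⟩⟩
  · exact ⟨0, fun _ x => isEmptyElim x⟩
  refine ⟨fun a => star (α a (star a • x₀)) * star (α (star a) x₀), fun a x => ?_⟩
  -- With `β(x) = α(a, 𝔍(a) x) α(𝔍(a), x)` the relation reads `1 = β(x₀) conj β(x)` for every `x`,
  -- so `conj β` is constant.
  have h1 := hα_mul a (star a) x₀ x
  have h2 := hα_mul a (star a) x₀ x₀
  rw [hα_star, hα_star, star_one, mul_one] at h1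
  rw [hα_star, star_one, mul_one] at h2
  have hne : α a (star a • x₀) * α (star a) x₀ ≠ 0 := fun h0 => one_ne_zero (α := ℂ) <| by
    linear_combination h2 + star (α a (star a • x₀)) * star (α (star a) x₀) * h0
  refine mul_left_cancel₀ hne ?_
  linear_combination h2 - h1

variable {H : Type*} [NormedAddCommGroup H] [InnerProductSpace ℂ H]
  {G : Type*} [NormedAddCommGroup G] [InnerProductSpace ℂ G]
  {α : S → X → ℂ} {V : X → H →L[ℂ] G} {U : S → G →L[ℂ] G}

theorem psi_single (α : S → X → ℂ) (a : S) (x : X) (ξ : H) :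
    psi α a (Finsupp.single x ξ) = (α a x)⁻¹ • Finsupp.single (a • x) ξ := by
  simp [psi]

theorem synthesis_psi (hα_ne : ∀ (a : S) (x : X), α a x ≠ 0)
    (hVU : ∀ (a : S) (x : X), V (a • x) = α a x • (U a ∘L V x)) (a : S) (f : X →₀ H) :
    synthesis V (psi α a f) = U a (synthesis V f) := by
  have : synthesis V ∘ₗ psi α a = (U a : G →ₗ[ℂ] G) ∘ₗ synthesis V := by
    refine Finsupp.lhom_ext fun x ξ => ?_
    simp [psi_single, synthesis_single, hVU, hα_ne]
  exact congr($this f)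

/-- Covariance fixes `U(a) U(b)` and `U(ab)` on the vectors `V(y) ξ`. The scalars match there
because `σ(a,b)` may be evaluated at `y`. -/
theorem IsProjectiveRepresentation.of_covariant (hα_ne : ∀ (a : S) (x : X), α a x ≠ 0)
    (hα_mul : IsMultiplier α) (hV : DenseRange (synthesis V))
    (hVU : ∀ (a : S) (x : X), V (a • x) = α a x • (U a ∘L V x)) :
    IsProjectiveRepresentation α U := by
  have hUV : ∀ a x, U a ∘L V x = (α a x)⁻¹ • V (a • x) := fun a x => by
    rw [hVU, smul_smul, inv_mul_cancel₀ (hα_ne a x), one_smul]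
  intro a b x
  refine clm_ext_of_denseRange hV fun y => ?_
  rw [comp_assoc, hUV, comp_smul, hUV, smul_comp, hUV, smul_smul, smul_smul,
    cocycle_eq hα_ne hα_mul a b x y, cocycle, smul_smul, mul_inv_cancel_right₀ (hα_ne _ _),
    mul_comm]

theorem IsPhiInvariant.add [StarMul S] {K K' : X → X → H →L[ℂ] H} (hK : IsPhiInvariant α K)
    (hK' : IsPhiInvariant α K') : IsPhiInvariant α (K + K') := by
  intro a x y
  change K x (a • y) + K' x (a • y) = _ • (K (star a • x) y + K' (star a • x) y)
  rw [hK, hK', smul_add]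

variable [CompleteSpace H] [KreinSpace H] [CompleteSpace G]

/-- Invariance of the kernel `V(x)♯ A V(y)` means `A U(a) = c(a) U(𝔍(a))* A`. -/
theorem isPhiInvariant_compression_iff [StarMul S] (hα_ne : ∀ (a : S) (x : X), α a x ≠ 0)
    {c : S → ℂ} (hc : ∀ a x, star (α a (star a • x)) * star (α (star a) x) = c a)
    (hV : DenseRange (synthesis V))
    (hVU : ∀ (a : S) (x : X), V (a • x) = α a x • (U a ∘L V x)) (A : G →L[ℂ] G) :
    IsPhiInvariant α (compression V A) ↔
      ∀ a, A ∘L U a = c a • (adjoint (U (star a)) ∘L A) := by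
  have h1 : ∀ a x y, compression V A x (a • y) = α a y • compression V (A ∘L U a) x y :=
    fun a x y => by
      ext ξ
      simp [compression, hVU]
  -- One conjugate factor comes from the definition of invariance, the other from the adjoint of
  -- `V(𝔍(a) x)`; their product is `c(a)`, independent of `x`.
  have h2 : ∀ a x y, (star (α a (star a • x)) * α a y) • compression V A (star a • x) y =
      α a y • compression V (c a • (adjoint (U (star a)) ∘L A)) x y := fun a x y => by
    ext ξ
    rw [← hc a x]
    simp only [compression, hVU, map_smulₛₗ, adjoint_comp, comp_apply, smul_apply, smul_smul,
      RingHom.id_apply]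
    congr 1
    simp only [Complex.star_def]
    ring
  simp only [IsPhiInvariant, h1, h2]
  refine forall_congr' fun a => ⟨fun h => compression_injective hV ?_, fun h x y => by rw [h]⟩
  funext x y
  exact smul_right_injective _ (hα_ne a y) (h x y)

/-- The seminorm of this kernel is `‖√A V f‖` and `ψ_a` acts as `U(a)`, so the intertwiner `W` gives
the bound `‖W‖`. -/
theorem isPhiBounded_compression (hα_ne : ∀ (a : S) (x : X), α a x ≠ 0)
    (hVU : ∀ (a : S) (x : X), V (a • x) = α a x • (U a ∘L V x)) {A : G →L[ℂ] G} (hA : 0 ≤ A)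
    (h : ∀ a, ∃ W, CFC.sqrt A * U a = W * CFC.sqrt A) : IsPhiBounded α (compression V A) := by
  intro a
  obtain ⟨W, hW⟩ := h a
  refine ⟨‖W‖, fun f => ?_⟩
  rw [kernelForm_compression, kernelForm_compression, synthesis_psi hα_ne hVU,
    re_inner_eq_norm_sqrt_sq hA, re_inner_eq_norm_sqrt_sq hA, Real.sqrt_sq (norm_nonneg _),
    Real.sqrt_sq (norm_nonneg _)]
  rw [show CFC.sqrt A (U a (synthesis V f)) = W (CFC.sqrt A (synthesis V f)) from
    congr($hW (synthesis V f))]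
  exact le_opNorm _ _

/-- The maps `ψ_a` extend to the Hilbert space of a `φ`-bounded kernel. -/
theorem IsPhiBounded.exists_covariant (hα_ne : ∀ (a : S) (x : X), α a x ≠ 0)
    (hV : DenseRange (synthesis V)) (hb : IsPhiBounded α (compression V 1)) :
    ∃ U : S → G →L[ℂ] G, ∀ (a : S) (x : X), V (a • x) = α a x • (U a ∘L V x) := by
  have hn : ∀ f, √(kernelForm (compression V 1) f f).re = ‖synthesis V f‖ := fun f => by
    rw [kernelForm_compression, one_apply_eq_self, norm_eq_sqrt_re_inner (𝕜 := ℂ)]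
    rfl
  refine ⟨fun a => (synthesis V ∘ₗ psi α a).extendOfNorm (synthesis V), fun a x => ?_⟩
  ext ξ
  have he := LinearMap.extendOfNorm_eq (f := synthesis V ∘ₗ psi α a) hV
    (by simpa only [hn, LinearMap.comp_apply] using hb a) (Finsupp.single x ξ)
  rw [synthesis_single] at he
  simp only [smul_apply, comp_apply, he]
  simp [psi_single, synthesis_single, hα_ne]

end Action

/-! ### The three implications -/

section Main

variable {S : Type w} [Monoid S] [StarMul S] {X : Type u} [MulAction S X]
  {H : Type v} [NormedAddCommGroup H] [InnerProductSpace ℂ H] [CompleteSpace H] [KreinSpace H]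
  {α : S → X → ℂ} {K : X → X → H →L[ℂ] H}

theorem exists_disjoint_decomposition (hα_ne : ∀ (a : S) (x : X), α a x ≠ 0)
    (hα_mul : IsMultiplier α) (hα_star : ∀ (a : S) (x : X), α (a * star a) x = 1)
    (hK : IsHermitian K) (hK_inv : IsPhiInvariant α K) {L : X → X → H →L[ℂ] H}
    (hL : IsPosDef L) (hLb : IsPhiBounded α L) (hLK : KernelLE (-L) K) (hKL : KernelLE K L)
    (hL_inv : IsPhiInvariant α L) :
    ∃ Kp Km : X → X → H →L[ℂ] H, IsPosDef Kp ∧ IsPosDef Km ∧ AreDisjoint Kp Km ∧ K = Kp - Km ∧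
      IsPosDef (Kp + Km) ∧ IsPhiBounded α (Kp + Km) ∧
      IsPhiInvariant α Kp ∧ IsPhiInvariant α Km := by
  obtain ⟨c, hc⟩ := exists_star_cocycle hα_mul hα_star
  obtain ⟨G, _, _, _, V, rfl, hV⟩ := hL.exists_dilation
  obtain ⟨U, hVU⟩ := hLb.exists_covariant hα_ne hV
  have hLn : ∀ f, (kernelForm (compression V 1) f f).re = ‖synthesis V f‖ ^ 2 := fun f => by
    rw [kernelForm_compression, one_apply_eq_self, ← inner_self_eq_norm_sq (𝕜 := ℂ)]
    rfl
  have hLKpos : IsPosDef (compression V 1 + K) := by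
    refine ⟨hL.1.add hK, fun f => ?_⟩
    have := hLK f
    rw [kernelForm_neg, Complex.neg_re] at this
    rw [kernelForm_add, Complex.add_re]
    linarith
  -- `K ≤ L` gives `L + K ≤ 2L`, whence the constant 2; the operator of `K` is then `B - 1`.
  obtain ⟨B, hB, hBK⟩ := hLKpos.exists_compression hV (C := 2) fun f => by
    have := hKL f
    rw [hLn] at this
    rw [kernelForm_add, Complex.add_re, hLn]
    linarith
  obtain ⟨A, hA, rfl⟩ : ∃ A, IsSelfAdjoint A ∧ K = compression V A :=
    ⟨B - 1, hB.isSelfAdjoint.sub (.one _), by rw [compression_sub, ← hBK, add_sub_cancel_left]⟩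
  -- Invariance of `L`, the case of the operator 1, turns the intertwining relation into
  -- commutation.
  have hU : ∀ a, U a = c a • adjoint (U (star a)) :=
    (isPhiInvariant_compression_iff hα_ne hc hV hVU 1).1 hL_inv
  have hcomm : ∀ a, Commute A (U a) := fun a => by
    have := (isPhiInvariant_compression_iff hα_ne hc hV hVU A).1 hK_inv a
    rwa [← smul_comp, ← hU] at this
  have hinv : ∀ T : G →L[ℂ] G, (∀ a, Commute T (U a)) → IsPhiInvariant α (compression V T) :=
    fun T hT => (isPhiInvariant_compression_iff hα_ne hc hV hVU T).2 fun a => by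
      rw [← smul_comp, ← hU]
      exact hT a
  have hp := CFC.posPart_nonneg A
  have hm := CFC.negPart_nonneg A
  have hcp : ∀ a, Commute A⁺ (U a) := fun a => (hcomm a).cfcₙ_real _
  have hcm : ∀ a, Commute A⁻ (U a) := fun a => (hcomm a).cfcₙ_real _
  refine ⟨compression V A⁺, compression V A⁻, isPosDef_compression V hp,
    isPosDef_compression V hm, ?_, ?_, ?_, ?_, hinv _ hcp, hinv _ hcm⟩
  · intro P hP hPp hPm
    obtain ⟨T, hT, rfl⟩ := hP.exists_compression hV (C := ‖A⁺‖) fun f => by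
      refine (hPp f).trans ?_
      rw [kernelForm_compression]
      refine (Complex.re_le_norm _).trans ((norm_inner_le_norm _ _).trans ?_)
      rw [sq, ← mul_assoc, mul_comm]
      gcongr
      exact le_opNorm _ _
    have hTp := le_of_kernelLE_compression hV hT.isSelfAdjoint hp.isSelfAdjoint hPp
    have hTm := le_of_kernelLE_compression hV hT.isSelfAdjoint hm.isSelfAdjoint hPm
    rw [eq_zero_of_le_of_le_of_mul_eq_zero hT hTp hTm (CFC.negPart_mul_posPart A),
      compression_zero]
  · rw [← compression_sub, CFC.posPart_sub_negPart A hA]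
  · rw [← compression_add]
    exact isPosDef_compression V (add_nonneg hp hm)
  · rw [← compression_add]
    -- `√(A⁺ + A⁻)` commutes with `U(a)`, so `U(a)` is its own intertwiner.
    refine isPhiBounded_compression hα_ne hVU (add_nonneg hp hm) fun a => ⟨U a, ?_⟩
    exact ((hcp a).add_left (hcm a)).cfcₙ_nnreal _

theorem exists_fundamentallyReducible_dilation (hα_ne : ∀ (a : S) (x : X), α a x ≠ 0)
    (hα_mul : IsMultiplier α) (hα_star : ∀ (a : S) (x : X), α (a * star a) x = 1)
    {Kp Km : X → X → H →L[ℂ] H} (hp : IsPosDef Kp) (hm : IsPosDef Km) (hd : AreDisjoint Kp Km)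
    (hL : IsPosDef (Kp + Km)) (hb : IsPhiBounded α (Kp + Km))
    (hp_inv : IsPhiInvariant α Kp) (hm_inv : IsPhiInvariant α Km) :
    ∃ (𝒦 : Type (max u v)) (_ : NormedAddCommGroup 𝒦) (_ : InnerProductSpace ℂ 𝒦)
      (_ : CompleteSpace 𝒦) (_ : KreinSpace 𝒦) (V : X → H →L[ℂ] 𝒦) (U : S → 𝒦 →L[ℂ] 𝒦),
      IsKolmogorovDecomposition (Kp - Km) V ∧ IsProjectiveRepresentation α U ∧
      (∀ (a : S) (x : X), V (a • x) = α a x • (U a ∘L V x)) ∧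
      IsFundamentallyReducible U := by
  obtain ⟨c, hc⟩ := exists_star_cocycle hα_mul hα_star
  have hL_inv := hp_inv.add hm_inv
  obtain ⟨G, _, _, _, V, hLV, hV⟩ := hL.exists_dilation
  rw [hLV] at hb hL_inv
  obtain ⟨U, hVU⟩ := hb.exists_covariant hα_ne hV
  have hLn : ∀ f, (kernelForm Kp f f).re + (kernelForm Km f f).re = 1 * ‖synthesis V f‖ ^ 2 :=
    fun f => by
      rw [← Complex.add_re, ← kernelForm_add, hLV, kernelForm_compression, one_apply_eq_self,
        one_mul, ← inner_self_eq_norm_sq (𝕜 := ℂ)]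
      rfl
  obtain ⟨P, hP, rfl⟩ := hp.exists_compression hV fun f => by
    have := hm.2 f
    rw [← hLn f]
    linarith
  obtain ⟨Q, hQ, rfl⟩ := hm.exists_compression hV fun f => by
    have := hp.2 f
    rw [← hLn f]
    linarith
  have hPQ : P + Q = 1 := compression_injective hV (by rw [compression_add, hLV])
  -- The kernel of `PQ` is positive definite and lies below both `K₊` and `K₋`.
  have hPQ0 : P * Q = 0 := by
    refine compression_injective hV ?_
    rw [compression_zero]
    exact hd _ (isPosDef_compression V (mul_nonneg_of_add_eq_one hP hQ hPQ))
      (kernelLE_compression V (mul_le_of_add_eq_one hP hPQ))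
      (kernelLE_compression V (mul_le_of_add_eq_one' hQ hPQ))
  have hU : ∀ a, U a = c a • adjoint (U (star a)) :=
    (isPhiInvariant_compression_iff hα_ne hc hV hVU 1).1 hL_inv
  have hcP : ∀ a, Commute P (U a) := fun a => by
    have := (isPhiInvariant_compression_iff hα_ne hc hV hVU P).1 hp_inv a
    rwa [← smul_comp, ← hU] at this
  have hcQ : ∀ a, Commute Q (U a) := fun a => by
    have := (isPhiInvariant_compression_iff hα_ne hc hV hVU Q).1 hm_inv a
    rwa [← smul_comp, ← hU] at this
  have hJ : (P - Q) * (P - Q) = 1 := by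
    have e : (P - Q) * (P - Q) = (P + Q) * (P + Q) - 2 • (P * Q) - 2 • (star (P * Q)) := by
      rw [star_mul, hP.isSelfAdjoint.star_eq, hQ.isSelfAdjoint.star_eq]
      noncomm_ring
    rw [e, hPQ, hPQ0]
    simp
  have hJs : adjoint (P - Q) = P - Q := (hP.isSelfAdjoint.sub hQ.isSelfAdjoint).adjoint_eq
  have hJJ : ∀ ξ, (P - Q) ((P - Q) ξ) = ξ := fun ξ => congr($hJ ξ)
  -- With `P - Q` as symmetry, `V(x)♯ V(y)` becomes `K₊ - K₋`, and the positive inner product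
  -- attached to `P - Q` is the original one of `G`.
  let κ : KreinSpace G := ⟨P - Q, hJs, hJJ⟩
  have hform : ∀ k : G, (form ((P - Q) k) k).re = ‖k‖ ^ 2 := fun k => by
    rw [← inner_self_eq_norm_sq (𝕜 := ℂ)]
    exact congr((inner ℂ k $(hJJ k)).re)
  refine ⟨G, _, _, _, κ, V, U, ⟨fun x y => ?_, ?_⟩,
    .of_covariant hα_ne hα_mul hV hVU, hVU, P - Q, ⟨hJJ, ?_, fun ξ hξ => ?_, fun u hu => ?_⟩,
    fun a => ?_⟩
  · rw [← compression_sub]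
    rfl
  · rw [← range_synthesis]
    exact hV
  · ext ξ
    change (P - Q) (adjoint (P - Q) ((P - Q) ξ)) = _
    rw [hJs, hJJ]
  · rw [hform]
    have := norm_pos_iff.2 hξ
    positivity
  · simp only [hform, Real.sqrt_sq (norm_nonneg _)] at hu ⊢
    have hc : CauchySeq u := Metric.cauchySeq_iff.2 fun ε hε => by
      obtain ⟨N, hN⟩ := hu ε hε
      exact ⟨N, fun m hm n hn => by rw [dist_eq_norm]; exact hN m n hm hn⟩
    obtain ⟨l, hl⟩ := cauchySeq_tendsto_of_complete hc
    exact ⟨l, tendsto_iff_norm_sub_tendsto_zero.1 hl⟩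
  · exact ((hcP a).sub_left (hcQ a)).symm

theorem exists_dominating_kernel (hα_ne : ∀ (a : S) (x : X), α a x ≠ 0)
    (hα_mul : IsMultiplier α) (hα_star : ∀ (a : S) (x : X), α (a * star a) x = 1)
    (hK_inv : IsPhiInvariant α K)
    {𝒦 : Type*} [NormedAddCommGroup 𝒦] [InnerProductSpace ℂ 𝒦] [CompleteSpace 𝒦] [KreinSpace 𝒦]
    {V : X → H →L[ℂ] 𝒦} {U : S → 𝒦 →L[ℂ] 𝒦} (hKV : IsKolmogorovDecomposition K V)
    (hVU : ∀ (a : S) (x : X), V (a • x) = α a x • (U a ∘L V x))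
    (hUF : IsFundamentallyReducible U) :
    ∃ L : X → X → H →L[ℂ] H, IsPosDef L ∧ IsPhiBounded α L ∧ KernelLE (-L) K ∧ KernelLE K L ∧
      IsPhiInvariant α L := by
  obtain ⟨c, hc⟩ := exists_star_cocycle hα_mul hα_star
  obtain ⟨F, hF, hUF⟩ := hUF
  have hV : DenseRange (synthesis V) := by
    rw [DenseRange, range_synthesis]
    exact hKV.2
  let J : 𝒦 →L[ℂ] 𝒦 := KreinSpace.symmetry
  have hKJ : K = compression V J := by
    funext x y
    exact hKV.1 x y
  have hJ : star J = J := KreinSpace.symmetry_selfAdjoint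
  have hJJ : J * J = 1 := ContinuousLinearMap.ext KreinSpace.symmetry_involutive
  have hFF : F * F = 1 := ContinuousLinearMap.ext hF.involutive
  -- `F` is selfadjoint for `[·,·]`, not necessarily for the given Hilbert inner product; this
  -- identity makes `JF` selfadjoint.
  have hJF : star F * J = J * F := by
    have h : J * (star F * J) = F := hF.selfAdjoint
    rw [← h, ← mul_assoc J J, hJJ, one_mul, h]
  have hT : 0 ≤ J * F := by
    rw [nonneg_iff_isPositive, isPositive_def']
    refine ⟨?_, fun k => ?_⟩
    · rw [IsSelfAdjoint, star_mul, hJ, hJF]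
    · rw [reApplyInnerSelf_apply, inner_re_symm]
      rcases eq_or_ne k 0 with rfl | hk
      · simp
      · exact (hF.pos k hk).le
  have hTJ : ∀ s : ℂ, star s = s → s * s = 1 → 0 ≤ J * F + s • J := fun s hs hss => by
    -- For `s = ±1` this is the identity behind `JF ± J ≥ 0`: `(F + s)/2` is, up to sign, a spectral
    -- projection of `F`, and conjugation by `F + s` preserves positivity.
    have e : J * F + s • J = (1 / 2 : ℝ) • (star (F + s • 1) * (J * F) * (F + s • 1)) := by
      have e1 : star F * (J * F) = J := by rw [← mul_assoc, hJF, mul_assoc, hFF, mul_one]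
      have e2 : J * F * F = J := by rw [mul_assoc, hFF, mul_one]
      rw [star_add, star_smul, hs, star_one, add_mul, e1, mul_add, add_mul, smul_mul_assoc,
        one_mul, smul_mul_assoc, e2, mul_smul_comm, mul_one, smul_add s, smul_smul s, hss, one_smul]
      generalize s • J = Y
      module
    rw [e]
    exact smul_nonneg (by norm_num) (star_left_conjugate_nonneg hT _)
  refine ⟨compression V (J * F), isPosDef_compression V hT, ?_, ?_, ?_, ?_⟩
  · refine isPhiBounded_compression hα_ne hVU hT fun a =>
      -- `JF` has inverse `FJ`, so the intertwiner is `T^{1/2} U(a) T⁻¹ T^{1/2}` with `T = JF`.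
      ⟨CFC.sqrt (J * F) * U a * (F * J) * CFC.sqrt (J * F), ?_⟩
    rw [mul_assoc _ (CFC.sqrt _) (CFC.sqrt _), CFC.sqrt_mul_sqrt_self _ hT, mul_assoc _ (F * J),
      mul_assoc F J, ← mul_assoc J J, hJJ, one_mul, hFF, mul_one]
  · rw [hKJ, ← zero_sub, ← compression_zero V, ← compression_sub]
    refine kernelLE_compression V ?_
    rw [zero_sub, neg_le_iff_add_nonneg']
    simpa using hTJ 1 (by simp) (by simp)
  · rw [hKJ]
    refine kernelLE_compression V ?_
    simpa [← sub_eq_add_neg] using hTJ (-1) (by simp) (by simp)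
  -- Invariance of `K` is `J U(a) = c(a) U(𝔍(a))* J`; multiply by `F` on the right and commute it
  -- past `U(a)`.
  · rw [hKJ, isPhiInvariant_compression_iff hα_ne hc hV hVU] at hK_inv
    rw [isPhiInvariant_compression_iff hα_ne hc hV hVU]
    intro a
    change (J ∘L F) ∘L U a = c a • (adjoint (U (star a)) ∘L J ∘L F)
    rw [comp_assoc, ← hUF, ← comp_assoc, hK_inv, smul_comp, comp_assoc]

end Main

end KreinKernel

end

theorem mainTheorem3 {S : Type w} [Monoid S] [StarMul S]
    {X : Type u} [MulAction S X]
    {H : Type v} [NormedAddCommGroup H] [InnerProductSpace ℂ H] [CompleteSpace H]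
    [KreinKernel.KreinSpace H]
    (α : S → X → ℂ) (hα_ne : ∀ (a : S) (x : X), α a x ≠ 0)
    (hα_mul : KreinKernel.IsMultiplier α)
    (hα_star : ∀ (a : S) (x : X), α (a * star a) x = 1)
    (K : X → X → H →L[ℂ] H) (hK : KreinKernel.IsHermitian K)
    (hK_inv : KreinKernel.IsPhiInvariant α K) :
    List.TFAE [
      ∃ L : X → X → H →L[ℂ] H, KreinKernel.IsPosDef L ∧ KreinKernel.IsPhiBounded α L ∧
        KreinKernel.KernelLE (-L) K ∧ KreinKernel.KernelLE K L ∧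
        KreinKernel.IsPhiInvariant α L,
      ∃ (𝒦 : Type (max u v)) (_ : NormedAddCommGroup 𝒦) (_ : InnerProductSpace ℂ 𝒦)
        (_ : CompleteSpace 𝒦) (_ : KreinKernel.KreinSpace 𝒦)
        (V : X → H →L[ℂ] 𝒦) (U : S → 𝒦 →L[ℂ] 𝒦),
        KreinKernel.IsKolmogorovDecomposition K V ∧
        KreinKernel.IsProjectiveRepresentation α U ∧
        (∀ (a : S) (x : X), V (a • x) = α a x • (U a ∘L V x)) ∧
        KreinKernel.IsFundamentallyReducible U,
      ∃ Kp Km : X → X → H →L[ℂ] H, KreinKernel.IsPosDef Kp ∧ KreinKernel.IsPosDef Km ∧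
        KreinKernel.AreDisjoint Kp Km ∧ K = Kp - Km ∧
        KreinKernel.IsPosDef (Kp + Km) ∧ KreinKernel.IsPhiBounded α (Kp + Km) ∧
        KreinKernel.IsPhiInvariant α Kp ∧ KreinKernel.IsPhiInvariant α Km] := by
  tfae_have 1 → 3 := fun ⟨_, hL, hLb, hLK, hKL, hL_inv⟩ =>
    KreinKernel.exists_disjoint_decomposition hα_ne hα_mul hα_star hK hK_inv hL hLb hLK hKL hL_inv
  tfae_have 3 → 2 := by
    rintro ⟨_, _, hp, hm, hd, rfl, hL, hb, hp_inv, hm_inv⟩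
    exact KreinKernel.exists_fundamentallyReducible_dilation hα_ne hα_mul hα_star hp hm hd hL hb
      hp_inv hm_inv
  tfae_have 2 → 1 := fun ⟨_, _, _, _, _, _, _, hKV, _, hVU, hUF⟩ =>
    KreinKernel.exists_dominating_kernel hα_ne hα_mul hα_star hK_inv hKV hVU hUF
  tfae_finish
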